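/- Theorem. Call *convex set* a convex subset of some $\mathbb{R}^n$ with nonempty interior, and *open set* an open subset of some $\mathbb{R}^n$ ($n \ge 0$). A function between two such sets is *smooth* if it has continuous derivatives of all orders, derivatives being taken within the set at points that are not interior. A *Chen space* (respectively a *diffeological space*) is a set $X$ together with, for each convex set (respectively open set) $D$, a set of functions $\varphi\colon D \to X$, called *plots in $X$*, such that 1. if $\varphi\colon D\to X$ is a plot and $f\colon D'\to D$ is a smooth function between convex (respectively open) sets, then $\varphi f$ is a plot; 2. if the convex (respectively open) sets $D_j\subseteq D$ form an open cover of $D$ (in the subspace topology of $D\subseteq\mathbb{R}^n$) and $\varphi|_{D_j}$ is a plot for every $j$, then $\varphi\colon D\to X$ is a plot; 3. every map from the one point of $\mathbb{R}^0$ to $X$ is a plot. A *smooth map* $f\colon X\to Y$ between two Chen (respectively diffeological) spaces is a function such that $f\varphi$ is a plot in $Y$ for every plot $\varphi$ in $X$. The category of Chen spaces and smooth maps, and likewise the category of diffeological spaces and smooth maps, has all small limits and all small colimits and is a quasitopos, that is: it has finite limits and finite colimits; it is locally cartesian closed (for every object $B$ the slice category over $B$ has finite products, and for every object $Y$ of this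 slice category the functor $-\times Y$ on it has a right adjoint); and it has a weak subobject classifier, i.e. an object $\Omega$ with a morphism $\top\colon 1\to\Omega$ such that for every strong monomorphism $i\colon A\to X$ there is a unique morphism $\chi\colon X\to\Omega$ for which $$\begin{array}{ccc} A & \xrightarrow{\ i\ } & X\\ \downarrow & & \downarrow{\scriptstyle\chi}\\ 1 & \xrightarrow{\ \top\ } & \Omega\end{array}$$ is a pullback square. (A monomorphism $i$ is strong if every commutative square $g p = i f$ with $p$ an epimorphism has a unique diagonal filler.) -/

import Mathlib

open CategoryTheory CategoryTheory.Limits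
open scoped ContDiff

universe u v w

namespace SmoothSpaces

/-! ### Quasitoposes -/

/-- A category `C` is cartesian closed if it has finite products and, for every object `Y`,
the functor `X ↦ X × Y` has a right adjoint. -/
structure IsCartesianClosed (C : Type w) [Category.{v} C] : Prop where
  hasFiniteProducts : HasFiniteProducts C
  isLeftAdjoint (Y : C) : (prod.functor.flip.obj Y : C ⥤ C).IsLeftAdjoint

/-- A category is locally cartesian closed if all its slice categories are cartesian closed. -/
def IsLocallyCartesianClosed (C : Type w) [Category.{v} C] : Prop :=
  ∀ B : C, IsCartesianClosed (Over B)

/-- `t : 1 ⟶ Ω` is a weak subobject classifier: for every strong monomorphism `i : A ⟶ X` there is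
a unique `χ : X ⟶ Ω` such that `i` is the pullback of `t` along `χ`. -/
def IsWeakSubobjectClassifier {C : Type w} [Category.{v} C] [HasTerminal C]
    {Ω : C} (t : ⊤_ C ⟶ Ω) : Prop :=
  ∀ ⦃A X : C⦄ (i : A ⟶ X), StrongMono i →
    ∃! χ : X ⟶ Ω, IsPullback i (terminal.from A) χ t

/-- A quasitopos is a locally cartesian closed category with finite limits, finite colimits and a
weak subobject classifier. -/
structure IsQuasitopos (C : Type w) [Category.{v} C] : Prop where
  hasFiniteLimits : HasFiniteLimits C
  hasFiniteColimits : HasFiniteColimits C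
  isLocallyCartesianClosed : IsLocallyCartesianClosed C
  exists_weakSubobjectClassifier :
    ∃ (Ω : C) (t : ⊤_ C ⟶ Ω), IsWeakSubobjectClassifier t

/-! ### Domains and smooth functions between them

Chen spaces and diffeological spaces have literally the same definition, except for the sets that
are used as domains of plots. So everything below is parametrized by a predicate `P` that says which
subsets of the spaces `ℝⁿ` are domains; it is instantiated at `IsConvexDomain` for Chen spaces and
at `IsOpenDomain` for diffeological spaces. -/

/-- The domains of plots of Chen spaces: convex subsets of `ℝⁿ` with nonempty interior. -/
def IsConvexDomain (n : ℕ) (s : Set (EuclideanSpace ℝ (Fin n))) : Prop :=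
  Convex ℝ s ∧ (interior s).Nonempty

/-- The domains of plots of diffeological spaces: open subsets of `ℝⁿ`. -/
def IsOpenDomain (n : ℕ) (s : Set (EuclideanSpace ℝ (Fin n))) : Prop :=
  IsOpen s

/-- A domain of type `P`: a natural number `n` and a subset of `ℝⁿ` satisfying `P`. -/
structure Domain (P : ∀ n : ℕ, Set (EuclideanSpace ℝ (Fin n)) → Prop) where
  dim : ℕ
  carrier : Set (EuclideanSpace ℝ (Fin dim))
  prop : P dim carrier

variable {P : ∀ n : ℕ, Set (EuclideanSpace ℝ (Fin n)) → Prop}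

/-- A function between domains is smooth if it has continuous derivatives of all orders. At points
of the domain that are not interior, derivatives are taken within the domain. (For domains as above,
which have unique derivatives at all their points, this is what `ContDiffOn ℝ ∞` says. The values
of `F` outside the domain play no role.) -/
def IsSmooth {D D' : Domain P} (f : D.carrier → D'.carrier) : Prop :=
  ∃ F : EuclideanSpace ℝ (Fin D.dim) → EuclideanSpace ℝ (Fin D'.dim),
    ContDiffOn ℝ ∞ F D.carrier ∧ ∀ x : D.carrier, F x = f x

/-! ### Smooth spaces -/

variable (P) in
/-- A smooth space with respect to the domains of type `P`: a set `X` together with, for each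
domain `D`, a set of functions `D → X`, called plots, such that
1. the composite of a plot with a smooth function between domains is a plot,
2. a function on a domain `D` whose restrictions to the members of a cover of `D` by domains that
   are open in `D` are plots is itself a plot,
3. every map from the one point of `ℝ⁰` to `X` is a plot. -/
structure SmoothSpace where
  carrier : Type u
  IsPlot : ∀ D : Domain P, (D.carrier → carrier) → Prop
  isPlot_comp : ∀ {D D' : Domain P} (φ : D.carrier → carrier) (f : D'.carrier → D.carrier),
    IsPlot D φ → IsSmooth f → IsPlot D' (φ ∘ f)
  isPlot_of_cover : ∀ (D : Domain P) (φ : D.carrier → carrier) (ι : Type)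
    (U : ι → Set (EuclideanSpace ℝ (Fin D.dim))) (hP : ∀ j, P D.dim (U j))
    (hsub : ∀ j, U j ⊆ D.carrier),
    (∀ j, IsOpen ((↑) ⁻¹' U j : Set D.carrier)) → (⋃ j, U j) = D.carrier →
    (∀ j, IsPlot ⟨D.dim, U j, hP j⟩ (φ ∘ Set.inclusion (hsub j))) → IsPlot D φ
  isPlot_point : ∀ (h : P 0 Set.univ) (φ : ↥(Set.univ : Set (EuclideanSpace ℝ (Fin 0))) → carrier),
    IsPlot ⟨0, Set.univ, h⟩ φ

namespace SmoothSpace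

/-- A smooth map between smooth spaces: a function whose composites with plots are plots. -/
@[ext]
structure Hom (X Y : SmoothSpace.{u} P) where
  toFun : X.carrier → Y.carrier
  isPlot_comp : ∀ (D : Domain P) (φ : D.carrier → X.carrier), X.IsPlot D φ → Y.IsPlot D (toFun ∘ φ)

/-- The category of smooth spaces and smooth maps. -/
instance : Category.{u} (SmoothSpace.{u} P) where
  Hom := Hom
  id X := ⟨id, fun _ _ h => h⟩
  comp f g := ⟨g.toFun ∘ f.toFun, fun D φ h => g.isPlot_comp D _ (f.isPlot_comp D φ h)⟩

end SmoothSpace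

/-- The category of Chen spaces (with underlying sets in `Type u`) and smooth maps. -/
abbrev ChenSpaceCat : Type (u + 1) := SmoothSpace.{u} IsConvexDomain

/-- The category of diffeological spaces (with underlying sets in `Type u`) and smooth maps. -/
abbrev DiffeologicalSpaceCat : Type (u + 1) := SmoothSpace.{u} IsOpenDomain

end SmoothSpaces

namespace SmoothSpaces

/-! Smooth spaces behave like sets with extra structure: the plots making a family of functions out
of a set smooth form a coarsest structure, and intersecting such structures gives finest ones. Hence
limits and colimits are those of underlying sets with the initial or final structure. A strong
monomorphism is, up to isomorphism, the inclusion of its image with the subspace structure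
(`isPlot_of_strongMono`), so it is determined by a subset. Since every function into an indiscrete
space is smooth, the indiscrete space of truth values classifies such subsets. In the slice over
`B`, the exponential of `Z` by `Y` is the space of pairs of a point `b` and a smooth map from the
fibre of `Y` over `b` to that of `Z` (`fiberMaps`). Its plots are chosen so that evaluation and
transposition are smooth; the work lies in checking the covering axiom. The class of domains enters
only through the two properties in `DomainClass`. -/

/-- A sufficient condition for the smooth spaces with respect to `P` to form a quasitopos: `ℝ⁰` is
a domain, and every point of a domain has arbitrarily small relatively open neighbourhoods that
are domains. -/
class DomainClass (P : ∀ n : ℕ, Set (EuclideanSpace ℝ (Fin n)) → Prop) : Prop where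
  point : P 0 Set.univ
  exists_nhd : ∀ {n : ℕ} {s : Set (EuclideanSpace ℝ (Fin n))}, P n s → ∀ x ∈ s,
    ∀ V : Set (EuclideanSpace ℝ (Fin n)), IsOpen V → x ∈ V →
      ∃ t, P n t ∧ x ∈ t ∧ t ⊆ s ∧ t ⊆ V ∧ IsOpen ((↑) ⁻¹' t : Set s)

instance : DomainClass IsOpenDomain where
  point := isOpen_univ
  exists_nhd {_ s} hs _ hx V hV hxV :=
    ⟨s ∩ V, hs.inter hV, ⟨hx, hxV⟩, Set.inter_subset_left, Set.inter_subset_right,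
      (hs.inter hV).preimage continuous_subtype_val⟩

instance : DomainClass IsConvexDomain where
  point := ⟨convex_univ, by simp⟩
  exists_nhd {_ s} hs x hx V hV hxV := by
    obtain ⟨r, hr, hrV⟩ := Metric.isOpen_iff.1 hV x hxV
    refine ⟨s ∩ Metric.ball x r, ⟨hs.1.inter (convex_ball x r), ?_⟩,
      ⟨hx, Metric.mem_ball_self hr⟩, Set.inter_subset_left,
      Set.inter_subset_right.trans hrV, ?_⟩
    -- `x` may be a boundary point, but a convex set with nonempty interior lies in the closure of
    -- that interior, so the ball around `x` meets `interior s`.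
    · have hcl : x ∈ closure (interior s) := by
        rw [hs.1.closure_interior_eq_closure_of_nonempty_interior hs.2]
        exact subset_closure hx
      obtain ⟨y, hy, hxy⟩ := Metric.mem_closure_iff.1 hcl r hr
      refine ⟨y, ?_⟩
      rw [interior_inter, Metric.isOpen_ball.interior_eq]
      exact ⟨hy, by rwa [Metric.mem_ball, dist_comm]⟩
    · simpa using Metric.isOpen_ball.preimage continuous_subtype_val

variable {P : ∀ n : ℕ, Set (EuclideanSpace ℝ (Fin n)) → Prop}

/-! ### Smooth functions between domains -/

theorem isSmooth_id (D : Domain P) : IsSmooth (id : D.carrier → D.carrier) :=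
  ⟨id, contDiffOn_id, fun _ => rfl⟩

theorem isSmooth_const (D : Domain P) {D' : Domain P} (c : D'.carrier) :
    IsSmooth (fun _ : D.carrier => c) :=
  ⟨fun _ => c, contDiffOn_const, fun _ => rfl⟩

theorem IsSmooth.comp {D D' D'' : Domain P} {g : D'.carrier → D''.carrier}
    {f : D.carrier → D'.carrier} (hg : IsSmooth g) (hf : IsSmooth f) : IsSmooth (g ∘ f) := by
  obtain ⟨G, hG, hGg⟩ := hg
  obtain ⟨F, hF, hFf⟩ := hf
  refine ⟨G ∘ F, hG.comp hF fun x hx => ?_, fun x => ?_⟩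
  · rw [hFf ⟨x, hx⟩]
    exact (f ⟨x, hx⟩).2
  · simp [hFf, hGg]

theorem IsSmooth.continuous {D D' : Domain P} {f : D.carrier → D'.carrier} (hf : IsSmooth f) :
    Continuous f := by
  obtain ⟨F, hF, hFf⟩ := hf
  refine continuous_induced_rng.2 ?_
  have h : D.carrier.domRestrict F = (↑) ∘ f := funext hFf
  exact h ▸ hF.continuousOn.domRestrict

/-- The restriction of a smooth function to subdomains is smooth. -/
theorem IsSmooth.restrict {D D' : Domain P} {f : D.carrier → D'.carrier} (hf : IsSmooth f)
    {s : Set (EuclideanSpace ℝ (Fin D.dim))} {t : Set (EuclideanSpace ℝ (Fin D'.dim))}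
    (hs : P _ s) (ht : P _ t) (hsD : s ⊆ D.carrier)
    (hst : ∀ x : s, (f (Set.inclusion hsD x) : EuclideanSpace ℝ (Fin D'.dim)) ∈ t) :
    IsSmooth (D := ⟨D.dim, s, hs⟩) (D' := ⟨D'.dim, t, ht⟩)
      (fun x => ⟨f (Set.inclusion hsD x), hst x⟩) := by
  obtain ⟨F, hF, hFf⟩ := hf
  exact ⟨F, hF.mono hsD, fun x => hFf (Set.inclusion hsD x)⟩

theorem isSmooth_inclusion (D : Domain P) {s : Set (EuclideanSpace ℝ (Fin D.dim))}
    (hs : P _ s) (hsD : s ⊆ D.carrier) :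
    IsSmooth (D := ⟨D.dim, s, hs⟩) (D' := D) (Set.inclusion hsD) :=
  ⟨id, contDiffOn_id, fun _ => rfl⟩

namespace SmoothSpace

/-- A constant function factors through the point `ℝ⁰`, where every map is a plot. -/
theorem isPlot_const [DomainClass P] (X : SmoothSpace.{u} P) (D : Domain P) (x : X.carrier) :
    X.IsPlot D (fun _ => x) :=
  X.isPlot_comp (D := ⟨0, Set.univ, DomainClass.point⟩) (fun _ => x)
    (fun _ => ⟨0, Set.mem_univ _⟩) (X.isPlot_point _ _) (isSmooth_const _ _)

@[ext]
theorem hom_ext {X Y : SmoothSpace.{u} P} {f g : X ⟶ Y}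
    (h : ∀ x, Hom.toFun f x = Hom.toFun g x) : f = g :=
  Hom.ext (funext h)

theorem congr_toFun {X Y : SmoothSpace.{u} P} {f g : X ⟶ Y} (h : f = g) (x : X.carrier) :
    Hom.toFun f x = Hom.toFun g x := by
  rw [h]

/-- The underlying set of a smooth space. -/
def forget : SmoothSpace.{u} P ⥤ Type u where
  obj X := X.carrier
  map f := TypeCat.ofHom (Hom.toFun f)

/-! ### Initial and final structures -/

/-- The coarsest smooth structure on `X` such that all `f i` are smooth. -/
def initial {ι : Type w} (X : Type u) (Y : ι → SmoothSpace.{u} P)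
    (f : ∀ i, X → (Y i).carrier) : SmoothSpace.{u} P where
  carrier := X
  IsPlot D φ := ∀ i, (Y i).IsPlot D (f i ∘ φ)
  isPlot_comp φ g hφ hg i := (Y i).isPlot_comp (f i ∘ φ) g (hφ i) hg
  isPlot_of_cover D φ κ U hP hsub ho hU h i :=
    (Y i).isPlot_of_cover D (f i ∘ φ) κ U hP hsub ho hU fun j => h j i
  isPlot_point h φ i := (Y i).isPlot_point h (f i ∘ φ)

/-- The finest smooth structure on `X` such that all `g i` are smooth. -/
def final {ι : Type w} (X : Type u) (Y : ι → SmoothSpace.{u} P)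
    (g : ∀ i, (Y i).carrier → X) : SmoothSpace.{u} P :=
  -- The universal property itself is taken as the definition: a plot is whatever every admissible
  -- map `k` out of `X` sends to a plot. This avoids generating plots by local factorizations.
  initial (ι := {k : Σ Z : SmoothSpace.{u} P, X → Z.carrier //
      ∀ i D φ, (Y i).IsPlot D φ → k.1.IsPlot D (k.2 ∘ g i ∘ φ)})
    X (fun k => k.1.1) (fun k => k.1.2)

theorem final_isPlot {ι : Type w} (X : Type u) (Y : ι → SmoothSpace.{u} P)
    (g : ∀ i, (Y i).carrier → X) (i : ι) (D : Domain P) (φ : D.carrier → (Y i).carrier)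
    (hφ : (Y i).IsPlot D φ) : (final X Y g).IsPlot D (g i ∘ φ) :=
  fun k => k.2 i D φ hφ

/-- A function out of a final structure is smooth if its composites with the structure maps are. -/
def finalDesc {ι : Type w} {X : Type u} {Y : ι → SmoothSpace.{u} P}
    {g : ∀ i, (Y i).carrier → X} {Z : SmoothSpace.{u} P} (k : X → Z.carrier)
    (hk : ∀ i D φ, (Y i).IsPlot D φ → Z.IsPlot D (k ∘ g i ∘ φ)) : final X Y g ⟶ Z :=
  Hom.mk k fun _ _ hφ => hφ ⟨⟨Z, k⟩, hk⟩

/-! ### Limits and colimits -/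

section Limits

variable {J : Type u} [Category.{u} J] (F : J ⥤ SmoothSpace.{u} P)

/-- The limit cone of a diagram of smooth spaces. -/
noncomputable def limitCone : Cone F where
  pt := initial (limit (F ⋙ forget)) F.obj (fun j => limit.π (F ⋙ forget) j)
  π :=
    { app j := Hom.mk (limit.π (F ⋙ forget) j) fun _ _ h => h j
      naturality i j a := by
        ext x
        exact (ConcreteCategory.congr_hom (limit.w (F ⋙ forget) a) x).symm }

/-- `limitCone F` is a limit cone. -/
noncomputable def limitConeIsLimit : IsLimit (limitCone F) where
  lift s := Hom.mk (limit.lift (F ⋙ forget) (forget.mapCone s)) fun D φ hφ j => by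
    convert Hom.isPlot_comp (s.π.app j) D φ hφ using 1
    funext x
    exact ConcreteCategory.congr_hom (limit.lift_π (forget.mapCone s) j) (φ x)
  fac s j := by
    ext x
    exact ConcreteCategory.congr_hom (limit.lift_π (forget.mapCone s) j) x
  uniq s m hm := by
    have h : forget.map m = limit.lift (F ⋙ forget) (forget.mapCone s) := by
      refine limit.hom_ext fun j => ?_
      rw [limit.lift_π]
      exact congrArg forget.map (hm j)
    ext x
    exact ConcreteCategory.congr_hom h x

/-- The colimit cocone of a diagram of smooth spaces. -/
noncomputable def colimitCocone : Cocone F where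
  pt := final (colimit (F ⋙ forget)) F.obj (fun j => colimit.ι (F ⋙ forget) j)
  ι :=
    { app j := Hom.mk (colimit.ι (F ⋙ forget) j) fun D φ hφ => final_isPlot _ _ _ j D φ hφ
      naturality i j a := by
        ext x
        exact ConcreteCategory.congr_hom (colimit.w (F ⋙ forget) a) x }

/-- `colimitCocone F` is a colimit cocone. -/
noncomputable def colimitCoconeIsColimit : IsColimit (colimitCocone F) where
  desc s := finalDesc (colimit.desc (F ⋙ forget) (forget.mapCocone s)) fun j D φ hφ => by
    have h : colimit.desc (F ⋙ forget) (forget.mapCocone s) ∘ colimit.ι (F ⋙ forget) j ∘ φ =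
        Hom.toFun (s.ι.app j) ∘ φ :=
      funext fun x => ConcreteCategory.congr_hom (colimit.ι_desc (forget.mapCocone s) j) (φ x)
    exact (congrArg (s.pt.IsPlot D) h).mpr (Hom.isPlot_comp (s.ι.app j) D φ hφ)
  fac s j := by
    ext x
    exact ConcreteCategory.congr_hom (colimit.ι_desc (forget.mapCocone s) j) x
  uniq s m hm := by
    have h : forget.map m = colimit.desc (F ⋙ forget) (forget.mapCocone s) := by
      refine colimit.hom_ext fun j => ?_
      rw [colimit.ι_desc]
      exact congrArg forget.map (hm j)
    ext x
    exact ConcreteCategory.congr_hom h x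

end Limits

instance : HasLimitsOfSize.{u, u} (SmoothSpace.{u} P) where
  has_limits_of_shape _ _ := ⟨fun F => ⟨⟨limitCone F, limitConeIsLimit F⟩⟩⟩

instance : HasColimitsOfSize.{u, u} (SmoothSpace.{u} P) where
  has_colimits_of_shape _ _ := ⟨fun F => ⟨⟨colimitCocone F, colimitCoconeIsColimit F⟩⟩⟩

instance : HasFiniteLimits (SmoothSpace.{u} P) :=
  hasFiniteLimits_of_hasLimitsOfSize.{u, u} _

instance : HasFiniteColimits (SmoothSpace.{u} P) :=
  hasFiniteColimits_of_hasColimitsOfSize.{u, u} _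

/-! ### The weak subobject classifier -/

/-- The smooth structure for which all functions are plots. -/
def indiscrete (X : Type u) : SmoothSpace.{u} P :=
  initial (ι := PEmpty.{1}) X PEmpty.elim (fun i => i.elim)

/-- All functions to an indiscrete space are smooth. -/
def toIndiscrete {X : SmoothSpace.{u} P} {Y : Type u} (f : X.carrier → Y) : X ⟶ indiscrete Y :=
  Hom.mk f fun _ _ _ i => i.elim

/-- A point of a smooth space, as a smooth map from the one-point space. -/
def pointHom [DomainClass P] {X : SmoothSpace.{u} P} (x : X.carrier) :
    (indiscrete PUnit : SmoothSpace.{u} P) ⟶ X :=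
  Hom.mk (fun _ => x) fun D _ _ => X.isPlot_const D x

theorem epi_of_surjective {X Y : SmoothSpace.{u} P} (f : X ⟶ Y)
    (hf : Function.Surjective (Hom.toFun f)) : Epi f where
  left_cancellation g h e := by
    ext y
    obtain ⟨x, rfl⟩ := hf y
    exact congr_toFun e x

/-- The subspace structure on a subset of a smooth space. -/
def subspace (X : SmoothSpace.{u} P) (s : Set X.carrier) : SmoothSpace.{u} P :=
  initial (ι := PUnit.{1}) s (fun _ => X) (fun _ => (↑))

/-- The inclusion of a subspace. -/
def subspaceι (X : SmoothSpace.{u} P) (s : Set X.carrier) : X.subspace s ⟶ X :=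
  Hom.mk (fun x => x.1) fun _ _ h => h PUnit.unit

/-- A smooth map with values in a subset is smooth as a map to the subspace. -/
def toSubspace {X Y : SmoothSpace.{u} P} (f : X ⟶ Y) (s : Set Y.carrier)
    (h : ∀ x, Hom.toFun f x ∈ s) : X ⟶ Y.subspace s :=
  Hom.mk (fun x => ⟨Hom.toFun f x, h x⟩) fun D φ hφ _ => Hom.isPlot_comp f D φ hφ

/-- The domain of a strong monomorphism carries the subspace structure. -/
theorem isPlot_of_strongMono {A X : SmoothSpace.{u} P} (i : A ⟶ X) [StrongMono i]
    {D : Domain P} {φ : D.carrier → A.carrier} (h : X.IsPlot D (Hom.toFun i ∘ φ)) :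
    A.IsPlot D φ := by
  -- The corestriction of `i` to its image is surjective, hence epi. Strength of `i` then gives a
  -- diagonal filler, a smooth left inverse of `e`, which carries plots of the subspace back to `A`.
  let e := toSubspace i (Set.range (Hom.toFun i)) fun x => ⟨x, rfl⟩
  have : Epi e := epi_of_surjective e fun ⟨_, a, ha⟩ => ⟨a, Subtype.ext ha⟩
  have := StrongMono.rlp (f := i) e
  have sq : CommSq (𝟙 A) e i (X.subspaceι _) := ⟨rfl⟩
  have hφ : (X.subspace (Set.range (Hom.toFun i))).IsPlot D (Hom.toFun e ∘ φ) := fun _ => h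
  have hl := Hom.isPlot_comp sq.lift D _ hφ
  have : Hom.toFun sq.lift ∘ Hom.toFun e ∘ φ = φ :=
    funext fun x => congr_toFun sq.fac_left (φ x)
  rwa [this] at hl

/-- The inclusion of the truth value `True` into the indiscrete space of truth values. -/
noncomputable def truth : ⊤_ SmoothSpace.{u} P ⟶ indiscrete (ULift.{u} Prop) :=
  toIndiscrete fun _ => ⟨True⟩

/-- Maps from the one-point space detect the underlying set of the pullback, and strength of `i`
forces its smooth structure. The criterion fixes `χ` pointwise, whence uniqueness of the classifying
map. -/
theorem isPullback_truth_iff [DomainClass P] {A X : SmoothSpace.{u} P} (i : A ⟶ X) [StrongMono i]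
    (χ : X ⟶ indiscrete (ULift.{u} Prop)) :
    IsPullback i (terminal.from A) χ truth ↔
      ∀ x, (Hom.toFun χ x : ULift.{u} Prop).down ↔ x ∈ Set.range (Hom.toFun i) := by
  have : Mono i := StrongMono.mono
  constructor
  · intro h x
    constructor
    · intro hx
      have w : pointHom x ≫ χ = terminal.from _ ≫ truth := by
        ext
        exact ULift.ext _ _ (eq_true hx)
      exact ⟨Hom.toFun (h.lift _ _ w) PUnit.unit, congr_toFun (h.lift_fst _ _ w) PUnit.unit⟩
    · rintro ⟨a, rfl⟩
      have := congr_toFun h.w a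
      exact of_eq_true (congrArg ULift.down this)
  · intro h
    have w : i ≫ χ = terminal.from A ≫ truth := by
      ext a
      exact ULift.ext _ _ (eq_true ((h _).2 ⟨a, rfl⟩))
    refine ⟨⟨w⟩, ⟨PullbackCone.IsLimit.mk w ?_ ?_ ?_ ?_⟩⟩
    · intro s
      have hs : ∀ x, ∃ a, Hom.toFun i a = Hom.toFun s.fst x := fun x =>
        (h _).1 (of_eq_true (congrArg ULift.down (congr_toFun s.condition x)))
      refine Hom.mk (fun x => (hs x).choose) fun D φ hφ => isPlot_of_strongMono i ?_
      convert Hom.isPlot_comp s.fst D φ hφ using 1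
      exact funext fun x => (hs (φ x)).choose_spec
    · intro s
      ext x
      exact ((h _).1 (of_eq_true (congrArg ULift.down (congr_toFun s.condition x)))).choose_spec
    · intro s
      exact Subsingleton.elim _ _
    · intro s m hm _
      rw [← cancel_mono i, hm]
      ext x
      exact ((h _).1 (of_eq_true
        (congrArg ULift.down (congr_toFun s.condition x)))).choose_spec.symm

theorem isWeakSubobjectClassifier_truth [DomainClass P] :
    IsWeakSubobjectClassifier (truth : ⊤_ SmoothSpace.{u} P ⟶ _) := by
  intro A X i hi
  refine ⟨toIndiscrete fun x => ⟨x ∈ Set.range (Hom.toFun i)⟩,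
    (isPullback_truth_iff i _).2 fun x => Iff.rfl, fun χ hχ => ?_⟩
  ext x
  exact ULift.ext _ _ (propext ((isPullback_truth_iff i χ).1 hχ x))

end SmoothSpace

/-! ### Local cartesian closure -/

/-- The functor `X ↦ X ⨯ Y` has a right adjoint if every object has an exponential by `Y`, where
the products in the universal property of the exponential may be chosen freely. -/
theorem isLeftAdjoint_prod_of_binaryFan {C : Type w} [Category.{v} C] [HasBinaryProducts C] (Y : C)
    (c : ∀ X : C, BinaryFan X Y) (hc : ∀ X, IsLimit (c X))
    (H : ∀ Z : C, ∃ (E : C) (ev : (c E).pt ⟶ Z), ∀ (X : C) (f : (c X).pt ⟶ Z),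
      ∃! g : X ⟶ E,
        (hc E).lift (BinaryFan.mk ((c X).fst ≫ g) (c X).snd) ≫ ev = f) :
    (prod.functor.flip.obj Y : C ⥤ C).IsLeftAdjoint := by
  -- The universal property of `(E, ev)` says that it is terminal among the maps `X ⨯ Y ⟶ Z` with
  -- `X` varying; the rest transports this along the isomorphisms `e` between the two choices of
  -- product.
  rw [isLeftAdjoint_iff_hasTerminal_costructuredArrow]
  intro Z
  obtain ⟨E, ev, hE⟩ := H Z
  let e (X : C) : X ⨯ Y ≅ (c X).pt := (prodIsProd X Y).conePointUniqueUpToIso (hc X)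
  let p (X : C) : (c X).pt ⟶ X := (c X).fst
  let q (X : C) : (c X).pt ⟶ Y := (c X).snd
  have e_fst (X : C) : (e X).hom ≫ p X = prod.fst :=
    (prodIsProd X Y).conePointUniqueUpToIso_hom_comp (hc X) ⟨.left⟩
  have e_snd (X : C) : (e X).hom ≫ q X = prod.snd :=
    (prodIsProd X Y).conePointUniqueUpToIso_hom_comp (hc X) ⟨.right⟩
  have key {X : C} (g : X ⟶ E) : prod.map g (𝟙 Y) ≫ (e E).hom =
      (e X).hom ≫ (hc E).lift (BinaryFan.mk ((c X).fst ≫ g) (c X).snd) := by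
    let l : (c X).pt ⟶ (c E).pt := (hc E).lift (BinaryFan.mk ((c X).fst ≫ g) (c X).snd)
    have l_fst : l ≫ p E = p X ≫ g := (hc E).fac _ ⟨.left⟩
    have l_snd : l ≫ q E = q X := (hc E).fac _ ⟨.right⟩
    have h_fst : (prod.map g (𝟙 Y) ≫ (e E).hom) ≫ p E = ((e X).hom ≫ l) ≫ p E := by
      simp [l_fst, e_fst, reassoc_of% e_fst X]
    have h_snd : (prod.map g (𝟙 Y) ≫ (e E).hom) ≫ q E = ((e X).hom ≫ l) ≫ q E := by
      simp [l_snd, e_snd]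
    exact BinaryFan.IsLimit.hom_ext (hc E) h_fst h_snd
  have key' {X : C} (g : X ⟶ E) (f : X ⨯ Y ⟶ Z) : prod.map g (𝟙 Y) ≫ (e E).hom ≫ ev = f ↔
      (hc E).lift (BinaryFan.mk ((c X).fst ≫ g) (c X).snd) ≫ ev = (e X).inv ≫ f := by
    rw [← Category.assoc, key, Category.assoc, Iso.eq_inv_comp]
  let T : CostructuredArrow (prod.functor.flip.obj Y) Z :=
    CostructuredArrow.mk (Y := E) ((e E).hom ≫ ev)
  refine IsTerminal.hasTerminal (X := T) (IsTerminal.ofUniqueHom (fun A => ?_) fun A m => ?_)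
  · exact CostructuredArrow.homMk (hE A.left ((e A.left).inv ≫ A.hom)).choose
      ((key' _ _).2 (hE A.left ((e A.left).inv ≫ A.hom)).choose_spec.1)
  · refine CostructuredArrow.hom_ext _ _ ?_
    exact (hE A.left ((e A.left).inv ≫ A.hom)).choose_spec.2 _
      ((key' _ _).1 (CostructuredArrow.w m))

namespace SmoothSpace

/-! ### Fibre products and exponentials in slice categories -/

variable {B X Y Z : SmoothSpace.{u} P}

/-- The fibre product of smooth spaces over `B`. -/
def fiberProd (p : X ⟶ B) (q : Y ⟶ B) : SmoothSpace.{u} P :=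
  initial (ι := Bool) {z : X.carrier × Y.carrier // Hom.toFun p z.1 = Hom.toFun q z.2}
    (fun b => bif b then X else Y)
    (fun b => match b with
      | true => fun z => z.1.1
      | false => fun z => z.1.2)

/-- The first projection of a fibre product. -/
def fiberProdFst (p : X ⟶ B) (q : Y ⟶ B) : fiberProd p q ⟶ X :=
  Hom.mk (fun z => z.1.1) fun _ _ h => h true

/-- The second projection of a fibre product. -/
def fiberProdSnd (p : X ⟶ B) (q : Y ⟶ B) : fiberProd p q ⟶ Y :=
  Hom.mk (fun z => z.1.2) fun _ _ h => h false

theorem fiberProd_isPlot {p : X ⟶ B} {q : Y ⟶ B} {D : Domain P}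
    {φ : D.carrier → (fiberProd p q).carrier} (hX : X.IsPlot D fun d => (φ d).1.1)
    (hY : Y.IsPlot D fun d => (φ d).1.2) : (fiberProd p q).IsPlot D φ
  | true => hX
  | false => hY

/-- The map into a fibre product determined by its components. -/
def fiberProdLift {p : X ⟶ B} {q : Y ⟶ B} (f : Z ⟶ X) (g : Z ⟶ Y) (h : f ≫ p = g ≫ q) :
    Z ⟶ fiberProd p q :=
  Hom.mk (fun z => ⟨(Hom.toFun f z, Hom.toFun g z), congr_toFun h z⟩) fun D φ hφ =>
    fiberProd_isPlot (Hom.isPlot_comp f D φ hφ) (Hom.isPlot_comp g D φ hφ)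

/-- The product of two objects of a slice category. -/
def overFan {B : SmoothSpace.{u} P} (X Y : Over B) : BinaryFan X Y :=
  BinaryFan.mk (P := Over.mk (fiberProdFst X.hom Y.hom ≫ X.hom))
    (Over.homMk (fiberProdFst X.hom Y.hom))
    (Over.homMk (fiberProdSnd X.hom Y.hom) (by
      ext z
      exact z.2.symm))

/-- `overFan X Y` is a product in the slice category. -/
def overFanIsLimit {B : SmoothSpace.{u} P} (X Y : Over B) : IsLimit (overFan X Y) :=
  BinaryFan.isLimitMk
    (fun s => Over.homMk (fiberProdLift s.fst.left s.snd.left ((Over.w s.fst).trans (Over.w s.snd).symm)) (by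
      ext z
      exact congr_toFun (Over.w s.fst) z))
    (fun _ => rfl) (fun _ => rfl)
    (fun s m h₁ h₂ => by
      ext z
      exact Subtype.ext (Prod.ext (congr_toFun (congrArg CommaMorphism.left h₁) z)
        (congr_toFun (congrArg CommaMorphism.left h₂) z)))

/-- A smooth map over `B` between fibres of `Y` and `Z` over the same point of `B`. -/
structure FiberMap (p : Y ⟶ B) (q : Z ⟶ B) where
  base : B.carrier
  map : ∀ y, Hom.toFun p y = base → Z.carrier
  toFun_map : ∀ y h, Hom.toFun q (map y h) = base
  isPlot_map : ∀ (D : Domain P) (ψ : D.carrier → Y.carrier), Y.IsPlot D ψ →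
    ∀ h : ∀ d, Hom.toFun p (ψ d) = base, Z.IsPlot D fun d => map (ψ d) (h d)

theorem FiberMap.ext_map {p : Y ⟶ B} {q : Z ⟶ B} {k l : FiberMap p q} (hb : k.base = l.base)
    (h : ∀ y hk hl, k.map y hk = l.map y hl) : k = l := by
  obtain ⟨b, m, _, _⟩ := k
  obtain ⟨b', m', _, _⟩ := l
  obtain rfl : b = b' := hb
  obtain rfl : m = m' := funext fun y => funext fun hy => h y hy hy
  rfl

/-- The proof argument of `map` depends on the base point, so equal fibre maps cannot simply be
rewritten inside an evaluation. -/
theorem FiberMap.map_congr {p : Y ⟶ B} {q : Z ⟶ B} {k l : FiberMap p q} (e : k = l) {y y'}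
    (ey : y = y') (hy : Hom.toFun p y = k.base) (hy' : Hom.toFun p y' = l.base) :
    k.map y hy = l.map y' hy' := by
  subst e ey
  rfl

/-- The space of smooth maps over `B` between fibres. A family of such maps is a plot if it is a
plot on base points and if evaluating it at plots in `Y` gives plots in `Z`. -/
def fiberMaps [DomainClass P] (p : Y ⟶ B) (q : Z ⟶ B) : SmoothSpace.{u} P where
  carrier := FiberMap p q
  IsPlot D φ := B.IsPlot D (fun d => (φ d).base) ∧
    -- The pairs `(f, ψ)` are the test plots of the pullback of `Y` to `D`. Allowing every `f` makes
    -- the condition stable under reparametrization; `f = id` gives smoothness of evaluation.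
    ∀ (D' : Domain P) (f : D'.carrier → D.carrier) (ψ : D'.carrier → Y.carrier), IsSmooth f →
      Y.IsPlot D' ψ → ∀ h : ∀ d, Hom.toFun p (ψ d) = (φ (f d)).base,
        Z.IsPlot D' fun d => (φ (f d)).map (ψ d) (h d)
  isPlot_comp φ g hφ hg := ⟨B.isPlot_comp _ g hφ.1 hg,
    fun D' f ψ hf hψ h => hφ.2 D' (g ∘ f) ψ (hg.comp hf) hψ h⟩
  isPlot_of_cover D φ ι U hP hsub ho hU H := by
    refine ⟨B.isPlot_of_cover D _ ι U hP hsub ho hU fun j => (H j).1, ?_⟩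
    intro D' f ψ hf hψ h
    -- The preimages under `f` of the sets `U j` are open in `D'` but need not be domains (they may
    -- fail to be convex), so they are refined by small domains around each point.
    have hloc : ∀ x : D'.carrier, ∃ (t : Set (EuclideanSpace ℝ (Fin D'.dim))) (_ : P _ t)
        (ht : t ⊆ D'.carrier) (j : ι), x.1 ∈ t ∧ IsOpen ((↑) ⁻¹' t : Set D'.carrier) ∧
          ∀ y : t, (f (Set.inclusion ht y) : EuclideanSpace ℝ (Fin D.dim)) ∈ U j := by
      intro x
      have hx : (f x : EuclideanSpace ℝ (Fin D.dim)) ∈ ⋃ j, U j := hU.symm ▸ (f x).2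
      obtain ⟨j, hj⟩ := Set.mem_iUnion.1 hx
      obtain ⟨V, hV, hVU⟩ := isOpen_induced_iff.1 ((ho j).preimage hf.continuous)
      have hmem : ∀ y : D'.carrier, y.1 ∈ V ↔ (f y).1 ∈ U j := fun y => Set.ext_iff.1 hVU y
      obtain ⟨t, hPt, hxt, htD, htV, hto⟩ :=
        DomainClass.exists_nhd D'.prop x.1 x.2 V hV ((hmem x).2 hj)
      exact ⟨t, hPt, htD, j, hxt, hto, fun y => (hmem (Set.inclusion htD y)).1 (htV y.2)⟩
    choose t hPt htD j hxt hto htU using hloc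
    refine Z.isPlot_of_cover D' _ D'.carrier t hPt htD hto ?_ fun x => ?_
    · exact Set.Subset.antisymm (Set.iUnion_subset htD)
        fun y hy => Set.mem_iUnion.2 ⟨⟨y, hy⟩, hxt ⟨y, hy⟩⟩
    · exact (H (j x)).2 ⟨D'.dim, t x, hPt x⟩
        (fun y => ⟨f (Set.inclusion (htD x) y), htU x y⟩) (ψ ∘ Set.inclusion (htD x))
        (hf.restrict (hPt x) (hP (j x)) (htD x) (htU x))
        (Y.isPlot_comp ψ _ hψ (isSmooth_inclusion D' (hPt x) (htD x)))
        fun y => h (Set.inclusion (htD x) y)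
  isPlot_point h₀ φ := by
    refine ⟨B.isPlot_point h₀ _, fun D' f ψ _ hψ h => ?_⟩
    -- As `ℝ⁰` is a single point, the family is one fixed fibre map `k`, and the condition reduces
    -- to smoothness of `k`.
    obtain ⟨k, hk⟩ : ∃ k, ∀ d, φ (f d) = k :=
      ⟨φ ⟨0, Set.mem_univ _⟩, fun d => congrArg φ (Subtype.ext (Subsingleton.elim _ _))⟩
    convert k.isPlot_map D' ψ hψ fun d => (h d).trans (by rw [hk]) using 2 with d
    exact FiberMap.map_congr (hk d) rfl _ _

/-- The projection of the space of smooth maps between fibres to the base. -/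
def fiberMapsBase [DomainClass P] (p : Y ⟶ B) (q : Z ⟶ B) : fiberMaps p q ⟶ B :=
  Hom.mk FiberMap.base fun _ _ h => h.1

/-- Evaluation of smooth maps between fibres. -/
def fiberMapsEval [DomainClass P] (p : Y ⟶ B) (q : Z ⟶ B) :
    fiberProd (fiberMapsBase p q) p ⟶ Z :=
  Hom.mk (fun z => FiberMap.map z.1.1 z.1.2 z.2.symm) fun D φ hφ =>
    (hφ true).2 D id (fun d => (φ d).1.2) (isSmooth_id D) (hφ false) fun d => (φ d).2.symm

/-- The transpose of a smooth map from a fibre product. -/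
def fiberMapsCurry [DomainClass P] (r : X ⟶ B) (p : Y ⟶ B) (q : Z ⟶ B) (f : fiberProd r p ⟶ Z)
    (hf : f ≫ q = fiberProdFst r p ≫ r) : X ⟶ fiberMaps p q :=
  Hom.mk (fun x =>
    { base := Hom.toFun r x
      map := fun y h => Hom.toFun f ⟨(x, y), h.symm⟩
      toFun_map := fun _ _ => congr_toFun hf _
      isPlot_map := fun D _ hψ _ =>
        Hom.isPlot_comp f D _ (fiberProd_isPlot (X.isPlot_const D x) hψ) })
    fun D φ hφ => ⟨Hom.isPlot_comp r D φ hφ, fun D' g _ hg hψ _ =>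
      Hom.isPlot_comp f D' _ (fiberProd_isPlot (X.isPlot_comp φ g hφ hg) hψ)⟩

theorem isLeftAdjoint_prod_over [DomainClass P] {B : SmoothSpace.{u} P} [HasBinaryProducts (Over B)]
    (Y : Over B) : (prod.functor.flip.obj Y : Over B ⥤ Over B).IsLeftAdjoint := by
  refine isLeftAdjoint_prod_of_binaryFan Y (fun X => overFan X Y) (fun X => overFanIsLimit X Y)
    fun Z => ⟨Over.mk (fiberMapsBase Y.hom Z.hom), Over.homMk (fiberMapsEval Y.hom Z.hom) ?_,
      fun X f => ⟨Over.homMk (fiberMapsCurry X.hom Y.hom Z.hom f.left (Over.w f)) rfl,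
        ?_, fun g hg => ?_⟩⟩
  · ext z
    exact FiberMap.toFun_map z.1.1 z.1.2 z.2.symm
  · rfl
  · ext x
    -- Compatibility with the maps to `B` fixes the base point, and compatibility with evaluation
    -- fixes all values.
    refine FiberMap.ext_map (congr_toFun (Over.w g) x) fun y hk hl => ?_
    exact congr_toFun (congrArg CommaMorphism.left hg) ⟨(x, y), hl.symm⟩

theorem isQuasitopos [DomainClass P] : IsQuasitopos (SmoothSpace.{u} P) where
  hasFiniteLimits := inferInstance
  hasFiniteColimits := inferInstance
  isLocallyCartesianClosed _ :=
    -- Products in a slice are wide pullbacks in the ambient category.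
    have := Over.ConstructProducts.over_finiteProducts_of_finiteWidePullbacks
    ⟨this, isLeftAdjoint_prod_over⟩
  exists_weakSubobjectClassifier := ⟨_, truth, isWeakSubobjectClassifier_truth⟩

end SmoothSpace

end SmoothSpaces

/-- The category of Chen spaces, and likewise the category of diffeological spaces, is a quasitopos
with all small limits and colimits. -/
theorem mainTheorem2 :
    (SmoothSpaces.IsQuasitopos SmoothSpaces.ChenSpaceCat.{u} ∧
      HasLimitsOfSize.{u, u} SmoothSpaces.ChenSpaceCat.{u} ∧
      HasColimitsOfSize.{u, u} SmoothSpaces.ChenSpaceCat.{u}) ∧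
    (SmoothSpaces.IsQuasitopos SmoothSpaces.DiffeologicalSpaceCat.{u} ∧
      HasLimitsOfSize.{u, u} SmoothSpaces.DiffeologicalSpaceCat.{u} ∧
      HasColimitsOfSize.{u, u} SmoothSpaces.DiffeologicalSpaceCat.{u}) :=
  ⟨⟨SmoothSpaces.SmoothSpace.isQuasitopos, inferInstance, inferInstance⟩,
    ⟨SmoothSpaces.SmoothSpace.isQuasitopos, inferInstance, inferInstance⟩⟩
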